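/- Let $\Sigma$ be a finite alphabet and let $X\subseteq\Sigma^{\mathbb N}$ be a subshift (a subset that is closed in the product topology and invariant under the left shift). Let $L_X$ be its language, i.e. the set of nonempty finite words occurring as a block in some element of $X$, and let $S_X=L_X\cup\{0\}$ be the semigroup in which the product of two words is their concatenation if that lies in $L_X$, and $0$ otherwise. For $\mu\in S_X$ let $\theta_\mu$ be the partial bijection $\nu\mapsto\mu\nu$ of $L_X$, with domain $\{\nu\in L_X:\mu\nu\neq0\}$ and range $\{\mu\nu:\nu\in L_X\}\setminus\{0\}$. Let $\mathfrak H(S_X)$ be the inverse semigroup of partial bijections of $L_X$ generated by the $\theta_\mu$, $\mu\in S_X$, and let $\mathcal E$ be its semilattice of idempotents, identified with the family of subsets $Y\subseteq L_X$ such that $\mathrm{id}_Y\in\mathfrak H(S_X)$; it contains $\emptyset$, which is its zero. Let $\hat{\mathcal E}$ be the space of characters of $\mathcal E$, i.e. of nonzero maps $\varphi:\mathcal E\to\{0,1\}$ with $\varphi(\emptyset)=0$ and $\varphi(Y\cap Z)=\varphi(Y)\varphi(Z)$, with the topology of pointwise convergence. For $Y\in\mathcal E$ let $1_Y\in C_0(\hat{\mathcal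 E})$ be the function $1_Y(\varphi)=\varphi(Y)$. Let $H=\ell^2(L_X)$ with canonical basis $(\delta_\nu)$, and let $K(H)$ be the algebra of compact operators on $H$. Let $\pi:\mathfrak H(S_X)\to B(H)$ be the representation with $\pi(f)\delta_\nu=\delta_{f(\nu)}$ if $\nu$ is in the domain of $f$, and $\pi(f)\delta_\nu=0$ otherwise. Put $T_\mu=\pi(\theta_\mu)$, let $\mathcal T_X$ be the closed $*$-subalgebra of $B(H)$ generated by $\{T_\mu:\mu\in L_X\}$, let $\mathcal M_X=(\mathcal T_X+K(H))/K(H)$, and let $q$ be the quotient map. The Matsumoto representation is $\rho=q\circ\pi:\mathfrak H(S_X)\to\mathcal M_X$. Let $\hat{\mathcal E}_{\mathrm{ess}}(S_X)$ be the set of essentially tight characters, i.e. of all $\varphi\in\hat{\mathcal E}$ such that $\varphi(Y)=\bigvee_{i=1}^n\varphi(Y_i)$ whenever $Y,Y_1,\dots,Y_n\in\mathcal E$ and the symmetric difference $Y\,\Delta\,\bigcup_{i=1}^nY_i$ is finite. Then there is a $*$-homomorphism $\Psi:C_0(\hat{\mathcal E})\to\mathcal M_X$ such that $\Psi(1_Y)=\rho(Y)$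 for all $Y\in\mathcal E$, and for every such $\Psi$ the support of $\rho$, namely the set of all $\varphi\in\hat{\mathcal E}$ such that $f(\varphi)=0$ for every $f\in\ker\Psi$, is equal to $\hat{\mathcal E}_{\mathrm{ess}}(S_X)$. -/

import Mathlib

open scoped ZeroAtInfty

namespace Matsumoto

open scoped Classical

noncomputable section

/-! ### `0`-left-cancellative semigroups, their inverse hulls and constructible sets -/

/-- A semigroup with zero is `0`-left-cancellative if `rs = rt ≠ 0` implies `s = t`. -/
class ZeroLeftCancellative (S : Type*) [SemigroupWithZero S] : Prop where
  eq_of_mul_eq : ∀ r s t : S, r * s = r * t → r * s ≠ 0 → s = t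

/-- The set `S' = S ∖ {0}`. -/
abbrev NonZero (S : Type*) [Zero S] : Type _ := {s : S // s ≠ 0}

section InverseHull

variable {S : Type*} [SemigroupWithZero S] [ZeroLeftCancellative S]

/-- The regular representation of `S` on `S'`: the partial bijection `θ_s` has domain
`F_s = {x ∈ S' : sx ≠ 0}`, range `E_s = sS ∖ {0}`, and `θ_s(x) = sx`. -/
def theta (s : S) : NonZero S ≃. NonZero S where
  toFun x := if h : s * x.1 ≠ 0 then some ⟨s * x.1, h⟩ else none
  invFun y := if h : ∃ x : NonZero S, s * x.1 = y.1 then some h.choose else none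
  inv x y := by
    constructor
    · intro h
      split_ifs at h with hx
      · simp only [Option.some.injEq] at h
        subst h
        simp [hx.choose_spec, y.2]
    · intro h
      split_ifs at h with hx
      · simp only [Option.some.injEq] at h
        subst h
        have hex : ∃ z : NonZero S, s * z.1 = s * x.1 := ⟨x, rfl⟩
        have heq : hex.choose = x := by
          apply Subtype.ext
          refine ZeroLeftCancellative.eq_of_mul_eq s _ _ hex.choose_spec ?_
          rw [hex.choose_spec]; exact hx
        rw [dif_pos hex, heq]

/-- Membership in the inverse hull of `S`: the inverse subsemigroup of the symmetric inverse
semigroup on `S'` generated by the `θ_s`.  Here `g.trans f` is the composition `f ∘ g` of partial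
bijections and `f.symm` is the inverse. -/
inductive MemInverseHull (S : Type*) [SemigroupWithZero S] [ZeroLeftCancellative S] :
    (NonZero S ≃. NonZero S) → Prop
  | theta (s : S) : MemInverseHull S (theta s)
  | inv {f : NonZero S ≃. NonZero S} : MemInverseHull S f → MemInverseHull S f.symm
  | comp {f g : NonZero S ≃. NonZero S} :
      MemInverseHull S f → MemInverseHull S g → MemInverseHull S (g.trans f)

variable (S) in
/-- The inverse hull `H(S)`. -/
abbrev InverseHull : Type _ := {f : NonZero S ≃. NonZero S // MemInverseHull S f}

/-- The identity map `id_Y` of a subset `Y ⊆ Ω`, as a partial bijection of `Ω`. -/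
def idOn {Ω : Type*} (Y : Set Ω) : Ω ≃. Ω := PEquiv.ofSet Y

variable (S) in
/-- The idempotent semilattice of `H(S)`.  The idempotents of the symmetric inverse semigroup on
`S'` are the identity maps `id_Y` of subsets `Y ⊆ S'`, and `id_Y` is identified with `Y`. -/
abbrev Constructible : Type _ := {Y : Set (NonZero S) // MemInverseHull S (idOn Y)}

/-- The element `id_Y` of `H(S)` corresponding to a constructible set `Y`. -/
def Constructible.toHull (Y : Constructible S) : InverseHull S := ⟨idOn Y.1, Y.2⟩

theorem idOn_trans_idOn {Ω : Type*} (X Y : Set Ω) :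
    (idOn X).trans (idOn Y) = idOn (X ∩ Y) := by
  apply PEquiv.ext
  intro a
  apply Option.ext
  intro b
  simp only [← Option.mem_def, idOn, PEquiv.mem_trans, PEquiv.mem_ofSet_iff, Set.mem_inter_iff]
  constructor
  · rintro ⟨c, ⟨rfl, h1⟩, rfl, h2⟩; exact ⟨rfl, h1, h2⟩
  · rintro ⟨rfl, h1, h2⟩; exact ⟨_, ⟨rfl, h1⟩, rfl, h2⟩

theorem theta_zero : theta (0 : S) = ⊥ := by
  ext a b
  show b ∈ (if h : (0 : S) * a.1 ≠ 0 then some (⟨0 * a.1, h⟩ : NonZero S) else none) ↔ _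
  simp

theorem idOn_empty {Ω : Type*} : idOn (∅ : Set Ω) = ⊥ := by
  ext a b; simp [idOn]

/-- The product of `id_X` and `id_Y` is `id_{X ∩ Y}`, so the meet is the intersection. -/
instance : SemilatticeInf (Constructible S) :=
  Subtype.semilatticeInf (P := fun Y : Set (NonZero S) => MemInverseHull S (idOn Y))
    (fun {X Y} hX hY => by
      have h := MemInverseHull.comp hY hX
      rw [idOn_trans_idOn] at h; exact h)

/-- The zero of the semilattice is the empty set. -/
instance : OrderBot (Constructible S) where
  bot := ⟨∅, by
    have h := MemInverseHull.theta (0 : S)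
    rw [theta_zero, ← idOn_empty] at h; exact h⟩
  bot_le Y := Set.empty_subset Y.1

end InverseHull

/-! ### Characters of a semilattice with zero, and supports -/

section Characters

variable (E : Type*) [SemilatticeInf E] [OrderBot E]

/-- The spectrum of a semilattice with zero: the nonzero maps `φ : E → {0,1}` such that `φ(0) = 0`
and `φ(xy) = φ(x)φ(y)`, with the topology of pointwise convergence. -/
abbrev Character : Type _ :=
  {φ : E → Bool // φ ⊥ = false ∧ (∀ x y, φ (x ⊓ y) = (φ x && φ y)) ∧ ∃ x, φ x = true}

variable {E}

theorem isClopen_character (e : E) : IsClopen {φ : Character E | φ.1 e = true} :=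
  (isClopen_discrete {true}).preimage ((continuous_apply e).comp continuous_subtype_val)

theorem isCompact_character (e : E) : IsCompact {φ : Character E | φ.1 e = true} := by
  rw [Subtype.isCompact_iff]
  have : (Subtype.val '' {φ : Character E | φ.1 e = true}) =
      {φ : E → Bool | φ ⊥ = false} ∩ (⋂ x, ⋂ y, {φ : E → Bool | φ (x ⊓ y) = (φ x && φ y)}) ∩
        {φ : E → Bool | φ e = true} := by
    ext φ
    simp only [Set.mem_image, Set.mem_ofPred_eq, Subtype.exists, exists_and_right, exists_eq_right,
      Set.mem_inter_iff, Set.mem_iInter]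
    constructor
    · rintro ⟨⟨h1, h2, h3⟩, h4⟩; exact ⟨⟨h1, h2⟩, h4⟩
    · rintro ⟨⟨h1, h2⟩, h4⟩; exact ⟨⟨h1, h2, e, h4⟩, h4⟩
  rw [this]
  apply IsClosed.isCompact
  refine ((isClosed_eq (continuous_apply _) continuous_const).inter ?_).inter
    (isClosed_eq (continuous_apply _) continuous_const)
  refine isClosed_iInter fun x => isClosed_iInter fun y => isClosed_eq (continuous_apply _) ?_
  have h : Continuous fun φ : E → Bool => (φ x, φ y) :=
    (continuous_apply x).prodMk (continuous_apply y)
  exact (continuous_of_discreteTopology (f := fun p : Bool × Bool => (p.1 && p.2))).comp h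

/-- The function `1_e ∈ C₀(Ê)`, `1_e(φ) = φ(e)`. -/
def charFun (e : E) : C₀(Character E, ℂ) where
  toFun φ := if φ.1 e = true then 1 else 0
  continuous_toFun := by
    have h := (IsLocallyConstant.iff_continuous
      (fun φ : Character E => φ.1 e)).2 ((continuous_apply e).comp continuous_subtype_val)
    exact (h.comp (fun b : Bool => if b = true then (1 : ℂ) else 0)).continuous
  zero_at_infty' := by
    refine tendsto_const_nhds.congr' ?_
    filter_upwards [(isCompact_character e).compl_mem_cocompact] with φ hφ
    exact (if_neg (c := φ.1 e = true) hφ).symm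

variable {A : Type*} [NonUnitalSemiring A] [Module ℂ A] [Star A]

/-- `Ψ` is the `*`-homomorphism `Ψ_π : C₀(Ê) → A` induced by `π`, that is, `Ψ(1_e) = π(e)`. -/
def IsInduced (π : E → A) (Ψ : C₀(Character E, ℂ) →⋆ₙₐ[ℂ] A) : Prop :=
  ∀ e, Ψ (charFun e) = π e

/-- For a `*`-homomorphism `Ψ` on `C₀(Ê)` the set of `φ` such that the evaluation at `φ` vanishes on
the kernel of `Ψ`.  Equivalently, writing `ker Ψ = C₀(U)` with `U ⊆ Ê` open, this is `Ê ∖ U`.  For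
`Ψ = Ψ_π` it is the support of `π`. -/
def support (Ψ : C₀(Character E, ℂ) →⋆ₙₐ[ℂ] A) : Set (Character E) :=
  {φ | ∀ f, Ψ f = 0 → f φ = 0}

end Characters

/-! ### Essentially tight characters -/

/-- The set `Ê_ess(S)` of characters on the constructible sets that are essentially tight relative
to the inclusion of the constructible sets in the power set of `S'`: `φ(X) = ⋁ φ(Y_i)` whenever `X`
and `⋃ Y_i` are equal modulo finite sets. -/
def essentiallyTight (S : Type*) [SemigroupWithZero S] [ZeroLeftCancellative S] :
    Set (Character (Constructible S)) :=
  {φ | ∀ (X : Constructible S) (n : ℕ) (Y : Fin n → Constructible S),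
    (symmDiff X.1 (⋃ i, (Y i).1)).Finite → (φ.1 X = true ↔ ∃ i, φ.1 (Y i) = true)}

/-! ### Compact operators and the quotient `B(H)/K(H)` -/

section Compact

variable (H : Type*) [NormedAddCommGroup H] [InnerProductSpace ℂ H] [CompleteSpace H]

/-- The ideal `K(H)` of compact operators in `B(H)`. -/
def compactIdeal : Ideal (H →L[ℂ] H) where
  carrier := {T | IsCompactOperator T}
  add_mem' := fun ha hb => ha.add hb
  zero_mem' := isCompactOperator_zero
  smul_mem' := fun c _ hx => hx.clm_comp c

instance : (compactIdeal H).IsTwoSided where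
  mul_mem_of_left := fun {a} b (ha : IsCompactOperator a) => ha.comp_clm b

variable {H}

theorem star_mem_compactIdeal {T : H →L[ℂ] H} (hT : T ∈ compactIdeal H) :
    star T ∈ compactIdeal H := by
  have hTT : IsCompactOperator (T * star T) := hT.comp_clm (star T)
  show IsCompactOperator (star T : H →L[ℂ] H)
  refine (isCompactOperator_iff_isCompact_closure_image_closedBall
    (star T : H →L[ℂ] H).toLinearMap one_pos).2 ?_
  have htb : TotallyBounded ((T * star T) '' Metric.closedBall (0 : H) 1) :=
    ((isCompactOperator_iff_isCompact_closure_image_closedBall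
      (T * star T : H →L[ℂ] H).toLinearMap one_pos).1 hTT).totallyBounded.subset subset_closure
  refine TotallyBounded.isCompact_of_isClosed ?_ isClosed_closure
  refine TotallyBounded.closure ?_
  rw [Metric.totallyBounded_iff]
  intro ε hε
  obtain ⟨t, hts, htf, hcov⟩ :=
    Metric.finite_approx_of_totallyBounded htb (ε ^ 2 / 2) (by positivity)
  have hts' : ∀ y : H, y ∈ t → ∃ a ∈ Metric.closedBall (0 : H) 1, (T * star T) a = y :=
    fun y hy => hts hy
  choose! g hg hgt using hts'
  refine ⟨(fun y => star T (g y)) '' t, htf.image _, ?_⟩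
  rintro _ ⟨x, hx, rfl⟩
  have hx' := hcov ⟨x, hx, rfl⟩
  simp only [Set.mem_iUnion, Metric.mem_ball, exists_prop] at hx'
  obtain ⟨y, hy, hxy⟩ := hx'
  simp only [Set.mem_iUnion, Metric.mem_ball, exists_prop, Set.exists_mem_image]
  refine ⟨y, hy, ?_⟩
  rw [← hgt y hy, dist_eq_norm, ← map_sub] at hxy
  have hgy := hg y hy
  simp only [Metric.mem_closedBall, dist_zero_right] at hx hgy
  have hd : ‖x - g y‖ ≤ 2 := (norm_sub_le _ _).trans (by linarith)
  have key : ‖star T (x - g y)‖ ^ 2 ≤ ‖(T * star T) (x - g y)‖ * ‖x - g y‖ := by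
    rw [← inner_self_eq_norm_sq (𝕜 := ℂ)]
    have h : inner ℂ (star T (x - g y)) (star T (x - g y)) =
        inner ℂ ((T * star T) (x - g y)) (x - g y) := by
      rw [ContinuousLinearMap.star_eq_adjoint, ContinuousLinearMap.adjoint_inner_right]
      rfl
    rw [h]
    exact (RCLike.re_le_norm _).trans (norm_inner_le_norm _ _)
  show dist (star T x) (star T (g y)) < ε
  rw [dist_eq_norm, ← map_sub]
  have h2 : ‖star T (x - g y)‖ ^ 2 < ε ^ 2 := by
    nlinarith [norm_nonneg ((T * star T) (x - g y)), norm_nonneg (x - g y)]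
  exact lt_of_pow_lt_pow_left₀ 2 hε.le h2

/-- The involution of `B(H)/K(H)`, `(T + K(H))* = T* + K(H)`. -/
instance : StarRing ((H →L[ℂ] H) ⧸ compactIdeal H) where
  star := Quotient.map' (s₁ := (compactIdeal H).quotientRel) (s₂ := (compactIdeal H).quotientRel)
    star (fun a b h => by
      rw [Submodule.quotientRel_def] at h ⊢
      rw [← star_sub]
      exact star_mem_compactIdeal h)
  star_involutive := by
    rintro ⟨a⟩
    exact congrArg (Ideal.Quotient.mk (compactIdeal H)) (star_star a)
  star_mul := by
    rintro ⟨a⟩ ⟨b⟩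
    exact congrArg (Ideal.Quotient.mk (compactIdeal H)) (star_mul a b)
  star_add := by
    rintro ⟨a⟩ ⟨b⟩
    exact congrArg (Ideal.Quotient.mk (compactIdeal H)) (star_add a b)

variable (H) in
/-- The quotient map `q : B(H) → B(H)/K(H)`. -/
def calkinMap : (H →L[ℂ] H) →⋆ₐ[ℂ] ((H →L[ℂ] H) ⧸ compactIdeal H) where
  __ := Ideal.Quotient.mkₐ ℂ (compactIdeal H)
  map_star' _ := rfl

/-- The `*`-subalgebra `B + K(H)` of `B(H)`. -/
def addCompacts (B : NonUnitalStarSubalgebra ℂ (H →L[ℂ] H)) :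
    NonUnitalStarSubalgebra ℂ (H →L[ℂ] H) where
  carrier := {T | ∃ b ∈ B, ∃ k ∈ compactIdeal H, T = b + k}
  add_mem' := by
    rintro _ _ ⟨b, hb, k, hk, rfl⟩ ⟨c, hc, l, hl, rfl⟩
    exact ⟨b + c, add_mem hb hc, k + l, add_mem hk hl, by abel⟩
  zero_mem' := ⟨0, zero_mem _, 0, zero_mem _, by simp⟩
  mul_mem' := by
    rintro _ _ ⟨b, hb, k, hk, rfl⟩ ⟨c, hc, l, hl, rfl⟩
    refine ⟨b * c, mul_mem hb hc, b * l + k * (c + l), add_mem ((compactIdeal H).mul_mem_left b hl)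
      ((compactIdeal H).mul_mem_right _ hk), by noncomm_ring⟩
  smul_mem' := by
    rintro z _ ⟨b, hb, k, hk, rfl⟩
    exact ⟨z • b, SMulMemClass.smul_mem z hb, z • k, IsCompactOperator.smul hk z, smul_add _ _ _⟩
  star_mem' := by
    rintro _ ⟨b, hb, k, hk, rfl⟩
    exact ⟨star b, star_mem hb, star k, star_mem_compactIdeal hk, star_add _ _⟩

end Compact

/-! ### The operators on `ℓ²(Ω)` induced by partial bijections of `Ω` -/

section Tau

variable {Ω : Type*}

/-- The Hilbert space `ℓ²(Ω)`. -/
abbrev Ell2 (Ω : Type*) : Type _ := lp (fun _ : Ω => ℂ) 2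

/-- The extension by `0` of `x : Ω → ℂ` to `Option Ω`, so that `x` can be evaluated at
`f.symm μ`, which is `none` off the range of `f`. -/
def extend (x : Ω → ℂ) (o : Option Ω) : ℂ := o.elim 0 x

theorem sum_extend_le (f : Ω ≃. Ω) (x : Ell2 Ω) (s : Finset Ω) :
    ∑ μ ∈ s, ‖extend x (f.symm μ)‖ ^ (2 : ENNReal).toReal ≤ ‖x‖ ^ (2 : ENNReal).toReal := by
  refine le_trans (le_of_eq ?_) (lp.sum_rpow_le_norm_rpow (by simp) x
    (s.filterMap f.symm fun _ _ _ h1 h2 => f.symm.inj h1 h2))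
  have hne : ∀ μ, ‖extend x (f.symm μ)‖ ^ (2 : ENNReal).toReal ≠ 0 → ∃ ν, f.symm μ = some ν := by
    intro μ hμ
    cases h : f.symm μ with
    | none => rw [h] at hμ; simp [extend] at hμ
    | some ν => exact ⟨ν, rfl⟩
  refine Finset.sum_bij_ne_zero (fun μ _ _ => (f.symm μ).getD μ) ?_ ?_ ?_ ?_
  · intro μ hs h
    obtain ⟨ν, hν⟩ := hne μ h
    rw [Finset.mem_filterMap]
    exact ⟨μ, hs, by simp [hν]⟩
  · intro μ hs h μ' hs' h' heq
    obtain ⟨ν, hν⟩ := hne μ h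
    obtain ⟨ν', hν'⟩ := hne μ' h'
    simp only [hν, hν', Option.getD_some] at heq
    subst heq
    exact f.symm.inj hν hν'
  · intro ν hν h
    rw [Finset.mem_filterMap] at hν
    obtain ⟨μ, hs, hμ⟩ := hν
    refine ⟨μ, hs, ?_, by simp [hμ]⟩
    rw [hμ]; exact h
  · intro μ hs h
    obtain ⟨ν, hν⟩ := hne μ h
    simp [hν, extend]

/-- The partial isometry `τ(f)` of `ℓ²(Ω)` induced by a partial bijection `f` of `Ω`; see
`tau_single`. -/
def tau (f : Ω ≃. Ω) : Ell2 Ω →L[ℂ] Ell2 Ω :=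
  LinearMap.mkContinuous
    { toFun := fun x => ⟨fun μ => extend x (f.symm μ), memℓp_gen' (sum_extend_le f x)⟩
      map_add' := fun x y => by
        ext μ
        show extend _ _ = extend _ _ + extend _ _
        cases f.symm μ <;> simp [extend, Option.elim]
      map_smul' := fun c x => by
        ext μ
        show extend _ _ = c • extend _ _
        cases f.symm μ <;> simp [extend, Option.elim] } 1
    (fun x => by
      rw [one_mul]
      exact lp.norm_le_of_forall_sum_le (by simp) (norm_nonneg _) (sum_extend_le f x))

theorem tau_apply (f : Ω ≃. Ω) (x : Ell2 Ω) (μ : Ω) : tau f x μ = extend x (f.symm μ) := rfl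

/-- `τ(f) δ_ν = δ_{f(ν)}` if `ν` lies in the domain of `f`, and `τ(f) δ_ν = 0` otherwise. -/
theorem tau_single (f : Ω ≃. Ω) (ν : Ω) :
    tau f (lp.single 2 ν 1) = (f ν).elim 0 (fun μ => lp.single 2 μ 1) := by
  ext μ
  rw [tau_apply]
  have h := f.eq_some_iff (a := ν) (b := μ)
  cases h1 : f.symm μ with
  | none =>
    rw [h1] at h
    cases h2 : f ν with
    | none => simp [extend]
    | some κ =>
      have : κ ≠ μ := by rintro rfl; simp [h2] at h
      simp [extend, lp.single_apply, this.symm]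
  | some κ =>
    rw [h1] at h
    cases h2 : f ν with
    | none =>
      have : κ ≠ ν := by rintro rfl; simp [h2] at h
      simp [extend, lp.single_apply, this]
    | some lam =>
      rw [h2] at h
      simp only [Option.some.injEq] at h
      simp [extend, lp.single_apply, Pi.single_apply, h, eq_comm (a := μ)]

theorem tau_trans (f g : Ω ≃. Ω) : tau (g.trans f) = tau f * tau g := by
  ext x μ
  show extend x ((g.trans f).symm μ) = extend (fun ν => extend x (g.symm ν)) (f.symm μ)
  rw [PEquiv.symm_trans_rev]
  show extend x ((f.symm μ).bind g.symm) = _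
  cases f.symm μ <;> rfl

theorem tau_symm (f : Ω ≃. Ω) : tau f.symm = star (tau f) := by
  rw [ContinuousLinearMap.star_eq_adjoint, ContinuousLinearMap.eq_adjoint_iff]
  intro x y
  rw [lp.inner_eq_tsum, lp.inner_eq_tsum]
  have hne : ∀ ν, inner ℂ (x ν) (tau f y ν) ≠ 0 → ∃ μ, f.symm ν = some μ := by
    intro ν hν
    rw [tau_apply] at hν
    cases h : f.symm ν with
    | none => rw [h] at hν; simp [extend] at hν
    | some μ => exact ⟨μ, rfl⟩
  refine tsum_eq_tsum_of_ne_zero_bij (fun ν => (f.symm ν.1).getD ν.1) ?_ ?_ ?_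
  · rintro ⟨ν, h⟩ ⟨ν', h'⟩ heq
    obtain ⟨μ, hμ⟩ := hne ν h
    obtain ⟨μ', hμ'⟩ := hne ν' h'
    simp only [hμ, hμ', Option.getD_some] at heq
    subst heq
    exact Subtype.ext (f.symm.inj hμ hμ')
  · intro μ h
    rw [Function.mem_support, tau_apply, PEquiv.symm_symm] at h
    cases h1 : f μ with
    | none => rw [h1] at h; simp [extend] at h
    | some ν =>
      have h2 : f.symm ν = some μ := f.eq_some_iff.2 h1
      rw [h1] at h
      refine ⟨⟨ν, ?_⟩, by simp [h2]⟩
      rw [Function.mem_support, tau_apply, h2]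
      exact h
  · rintro ⟨ν, h⟩
    obtain ⟨μ, hμ⟩ := hne ν h
    have h1 : f μ = some ν := f.eq_some_iff.1 hμ
    simp [tau_apply, hμ, h1, extend]

end Tau

/-! ### The algebras `T_X` and `M_X`, and the Matsumoto representation -/

section Rep

variable {S : Type*} [SemigroupWithZero S] [ZeroLeftCancellative S]

/-- The operator `T_ν` on `ℓ²(S')`: `T_ν δ_μ = δ_{νμ}` if `νμ ≠ 0`, and `T_ν δ_μ = 0` otherwise. -/
def opT (ν : S) : Ell2 (NonZero S) →L[ℂ] Ell2 (NonZero S) := tau (theta ν)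

variable (S) in
/-- The closed `*`-subalgebra `T` of `B(ℓ²(S'))` generated by the `T_ν`, `ν ∈ S'`. -/
def algT : NonUnitalStarSubalgebra ℂ (Ell2 (NonZero S) →L[ℂ] Ell2 (NonZero S)) :=
  (NonUnitalStarAlgebra.adjoin ℂ
    (Set.range fun ν : NonZero S => opT ν.1)).topologicalClosure

variable (S) in
/-- The algebra `M = (T + K)/K`, where `K` is the algebra of compact operators on `ℓ²(S')`; it
consists of the cosets `b + K` with `b ∈ T + K`. -/
def algM : NonUnitalStarSubalgebra ℂ
    ((Ell2 (NonZero S) →L[ℂ] Ell2 (NonZero S)) ⧸ compactIdeal (Ell2 (NonZero S))) :=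
  (addCompacts (algT S)).map (calkinMap (Ell2 (NonZero S)))

/-- The inverse semigroup representation `π` of `H(S)` on `ℓ²(S')`, with `π(θ_ν) = T_ν`. -/
def repPi (f : InverseHull S) : Ell2 (NonZero S) →L[ℂ] Ell2 (NonZero S) := tau f.1

theorem opT_zero : opT (0 : S) = 0 := by
  ext x μ
  show extend x ((theta (0 : S)).symm μ) = 0
  rw [theta_zero]
  rfl

theorem repPi_mem (f : InverseHull S) : repPi f ∈ algT S := by
  obtain ⟨f, hf⟩ := f
  show tau f ∈ algT S
  induction hf with
  | theta s =>
    by_cases hs : s = 0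
    · subst hs
      have h : tau (theta (0 : S)) = 0 := opT_zero
      rw [h]; exact zero_mem _
    · exact NonUnitalStarSubalgebra.le_topologicalClosure _
        (NonUnitalStarAlgebra.subset_adjoin ℂ _ ⟨⟨s, hs⟩, rfl⟩)
  | inv _ ih => rw [tau_symm]; exact star_mem ih
  | comp _ _ ih1 ih2 => rw [tau_trans]; exact mul_mem ih1 ih2

/-- The Matsumoto representation `ρ = q ∘ π : H(S) → M`. -/
def rho (f : InverseHull S) : algM S :=
  ⟨calkinMap _ (repPi f), repPi f, ⟨repPi f, repPi_mem f, 0, zero_mem _, by simp⟩, rfl⟩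

end Rep

/-! ### The semigroup of a subshift -/

section Subshift

open SymbolicDynamics.FullShift

variable {A : Type*} [TopologicalSpace A]

/-- The language `L_X` of a one-sided subshift: the nonempty finite words occurring as a block in
some element of `X`. -/
def language (X : Subshift A ℕ) : Set (List A) :=
  {w | w ≠ [] ∧ ∃ x ∈ X.carrier, ∃ k : ℕ, ∀ (i : ℕ) (hi : i < w.length), w[i] = x (k + i)}

/-- The semigroup `S_X = L_X ∪ {0}`. -/
inductive SX (X : Subshift A ℕ) : Type _
  | zero : SX X
  | word (w : List A) (hw : w ∈ language X) : SX X

variable {X : Subshift A ℕ}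

/-- Concatenation if the result is in `L_X`, and `0` otherwise. -/
def SX.mul : SX X → SX X → SX X
  | .word u _, .word v _ => if h : u ++ v ∈ language X then .word (u ++ v) h else .zero
  | _, _ => .zero

theorem language_append_left {u v : List A} (hu : u ≠ []) (h : u ++ v ∈ language X) :
    u ∈ language X := by
  obtain ⟨-, x, hx, k, hk⟩ := h
  refine ⟨hu, x, hx, k, fun i hi => ?_⟩
  rw [← hk i (by simp; omega), List.getElem_append_left hi]

theorem language_append_right {u v : List A} (hv : v ≠ []) (h : u ++ v ∈ language X) :
    v ∈ language X := by
  obtain ⟨-, x, hx, k, hk⟩ := h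
  refine ⟨hv, x, hx, k + u.length, fun i hi => ?_⟩
  have := hk (u.length + i) (by simp; omega)
  rw [List.getElem_append_right (by omega)] at this
  simpa [add_assoc] using this

instance : SemigroupWithZero (SX X) where
  zero := .zero
  mul := SX.mul
  zero_mul _ := rfl
  mul_zero a := by cases a <;> rfl
  mul_assoc a b c := by
    show SX.mul (SX.mul a b) c = SX.mul a (SX.mul b c)
    rcases a with _ | ⟨u, hu⟩
    · rfl
    rcases b with _ | ⟨v, hv⟩
    · rfl
    rcases c with _ | ⟨w, hw⟩
    · simp only [SX.mul]; split_ifs <;> rfl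
    by_cases h : u ++ v ++ w ∈ language X
    · have h1 : u ++ v ∈ language X := language_append_left (by simp [hu.1]) h
      rw [List.append_assoc] at h
      have h2 : v ++ w ∈ language X := language_append_right (by simp [hv.1]) h
      simp [SX.mul, h1, h2]
    · have h' : u ++ (v ++ w) ∉ language X := by rwa [← List.append_assoc]
      by_cases h1 : u ++ v ∈ language X <;> by_cases h2 : v ++ w ∈ language X <;>
        simp [SX.mul, h1, h2, h']

instance : ZeroLeftCancellative (SX X) where
  eq_of_mul_eq a b c := by
    show SX.mul a b = SX.mul a c → SX.mul a b ≠ SX.zero → b = c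
    intro h hne
    rcases a with _ | ⟨u, hu⟩
    · exact absurd rfl hne
    rcases b with _ | ⟨v, hv⟩
    · exact absurd rfl hne
    rcases c with _ | ⟨w, hw⟩
    · exact absurd h hne
    by_cases h1 : u ++ v ∈ language X <;> by_cases h2 : u ++ w ∈ language X <;>
      simp_all [SX.mul]

end Subshift

end

end Matsumoto

open Matsumoto

/-! The spectrum of the semilattice has a basis of clopen sets, each cut out by an `e` where a
character is `1` and a finite set `F` where it is `0`. The indicator of such a set is the polynomial
`1_e ∏ (1 - 1_z)`, so any induced `Ψ` is determined on it. Under the diagonal representation it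
becomes the coordinate projection of `ℓ²` onto `Y \ ⋃ F`, and a coordinate projection is compact
exactly when its set is finite. Hence `Ψ` kills the indicator iff `Y \ ⋃ F` is finite
(`IsInduced.indicator_eq_zero_iff`).

A function in `ker Ψ` that is nonzero at `φ` can be multiplied into the indicator of a basic clopen
neighbourhood of `φ` (`exists_mul_eq_indicator`). So `φ` lies in the support iff no basic clopen set
containing `φ` has finite `Y \ ⋃ F`, which is essential tightness rephrased.

For existence, `f` acts diagonally on `δ_ν` by its value at the character `Y ↦ [ν ∈ Y]`. Density of
the span of the `1_Y` puts these operators in `algT`, and `calkinMap` then maps them into `algM`. -/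

namespace Matsumoto
open scoped Classical Topology
open Filter

noncomputable section

/-! ### Basic clopen sets of characters and their indicator functions -/

section BasicClopens

variable {E : Type*} [SemilatticeInf E] [OrderBot E]

/-- The basic clopen set of characters that are `1` at `e` and `0` on `F`. -/
def basicClopen (e : E) (F : Finset E) : Set (Character E) :=
  {φ | φ.1 e = true ∧ ∀ z ∈ F, φ.1 z = false}

/-- A neighbourhood constrains finitely many coordinates. Those where `φ` is `1` merge into a single
`e` by taking meets, since characters are multiplicative; the meet starts from some `x₀` with `φ x₀
= 1`, which exists because `φ` is nonzero. -/
theorem exists_basicClopen_subset {φ : Character E} {U : Set (Character E)} (hU : U ∈ 𝓝 φ) :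
    ∃ e F, φ ∈ basicClopen e F ∧ basicClopen e F ⊆ U := by
  obtain ⟨V, hV, hVU⟩ := mem_nhds_subtype _ _ _ |>.1 hU
  rw [nhds_pi, Filter.mem_pi] at hV
  obtain ⟨I, hI, t, ht, htV⟩ := hV
  obtain ⟨-, hmul, x₀, hx₀⟩ := φ.2
  have key : ∀ J : Finset E, ∃ e, φ.1 e = true ∧ ∀ ψ : Character E, ψ.1 e = true →
      ∀ z ∈ J, φ.1 z = true → ψ.1 z = true := by
    intro J
    induction J using Finset.induction_on with
    | empty => exact ⟨x₀, hx₀, by simp⟩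
    | insert a J _ ih =>
      obtain ⟨e, he, h⟩ := ih
      by_cases ha : φ.1 a = true
      · refine ⟨e ⊓ a, by simp [hmul, he, ha], fun ψ hψ z hz hzφ => ?_⟩
        rw [ψ.2.2.1, Bool.and_eq_true] at hψ
        rcases Finset.mem_insert.1 hz with rfl | hz
        · exact hψ.2
        · exact h ψ hψ.1 z hz hzφ
      · refine ⟨e, he, fun ψ hψ z hz hzφ => ?_⟩
        rcases Finset.mem_insert.1 hz with rfl | hz
        · exact absurd hzφ ha
        · exact h ψ hψ z hz hzφ
  obtain ⟨e, he, h⟩ := key hI.toFinset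
  refine ⟨e, hI.toFinset.filter fun z => φ.1 z = false, ⟨he, by simp⟩, ?_⟩
  rintro ψ ⟨hψe, hψF⟩
  apply hVU
  apply htV
  intro z hz
  have hzz : ψ.1 z = φ.1 z := by
    cases hb : φ.1 z with
    | true => exact h ψ hψe z (by simpa using hz) hb
    | false => exact hψF z (by simp [hb]; exact hz)
  rw [hzz]
  exact mem_of_mem_nhds (ht z)

theorem charFun_apply (e : E) (φ : Character E) :
    charFun e φ = if φ.1 e = true then 1 else 0 := rfl

/-- The indicator function of `basicClopen e F`, as `1_e ∏ (1 - 1_z)`. -/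
theorem exists_indicator_basicClopen (e : E) (F : Finset E) :
    ∃ p ∈ NonUnitalStarAlgebra.adjoin ℂ (Set.range (charFun (E := E))),
      ∀ φ, p φ = if φ ∈ basicClopen e F then 1 else 0 := by
  induction F using Finset.induction_on with
  | empty =>
    exact ⟨charFun e, NonUnitalStarAlgebra.subset_adjoin ℂ _ ⟨e, rfl⟩,
      fun φ => by simp [charFun_apply, basicClopen]⟩
  | insert a F _ ih =>
    obtain ⟨p, hp, h⟩ := ih
    refine ⟨p - p * charFun a, sub_mem hp (mul_mem hp
      (NonUnitalStarAlgebra.subset_adjoin ℂ _ ⟨a, rfl⟩)), fun φ => ?_⟩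
    rw [ZeroAtInftyContinuousMap.sub_apply, ZeroAtInftyContinuousMap.mul_apply, h, charFun_apply]
    have hm : φ ∈ basicClopen e (insert a F) ↔ φ ∈ basicClopen e F ∧ ¬ φ.1 a = true := by
      simp only [basicClopen, Set.mem_ofPred_eq, Finset.forall_mem_insert, Bool.not_eq_true]
      tauto
    rw [hm]
    by_cases h1 : φ ∈ basicClopen e F <;> by_cases h2 : φ.1 a = true <;> simp [h1, h2]

/-- Locally `f` is nearly constant, hence close to a multiple of an indicator. Compactness patches
finitely many such pieces, and outside a large compact set `f` is already small. -/
theorem adjoin_charFun_dense (f : C₀(Character E, ℂ)) :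
    f ∈ (NonUnitalStarAlgebra.adjoin ℂ (Set.range (charFun (E := E)))).topologicalClosure := by
  set D := NonUnitalStarAlgebra.adjoin ℂ (Set.range (charFun (E := E)))
  show f ∈ closure (D : Set C₀(Character E, ℂ))
  rw [Metric.mem_closure_iff]
  intro ε hε
  -- Here `p` is the indicator of a set containing `K`; `g` approximates `f` on that set and
  -- vanishes off it.
  have hloc : ∀ K : Set (Character E), IsCompact K → ∃ p ∈ D, ∃ g ∈ D, ∀ φ,
      (p φ = 0 ∧ g φ = 0 ∧ φ ∉ K) ∨ (p φ = 1 ∧ ‖f φ - g φ‖ ≤ ε / 2) := by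
    intro K hK
    refine hK.induction_on (p := fun K => ∃ p ∈ D, ∃ g ∈ D, ∀ φ,
      (p φ = 0 ∧ g φ = 0 ∧ φ ∉ K) ∨ (p φ = 1 ∧ ‖f φ - g φ‖ ≤ ε / 2)) ?_ ?_ ?_ ?_
    · exact ⟨0, zero_mem _, 0, zero_mem _, by simp⟩
    · rintro s t hst ⟨p, hp, g, hg, h⟩
      exact ⟨p, hp, g, hg, fun φ => (h φ).imp (fun h => ⟨h.1, h.2.1, fun hs => h.2.2 (hst hs)⟩) id⟩
    · rintro s t ⟨p, hp, g, hg, h⟩ ⟨p', hp', g', hg', h'⟩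
      -- The first function is the indicator of the union; the second is `g + (1 - p) g'`, which
      -- uses `g'` only where `p` vanishes.
      refine ⟨p + p' - p * p', sub_mem (add_mem hp hp') (mul_mem hp hp'),
        g + g' - p * g', sub_mem (add_mem hg hg') (mul_mem hp hg'), fun φ => ?_⟩
      simp only [ZeroAtInftyContinuousMap.sub_apply, ZeroAtInftyContinuousMap.add_apply,
        ZeroAtInftyContinuousMap.mul_apply]
      rcases h φ with ⟨h1, h2, h3⟩ | ⟨h1, h2⟩
      · rcases h' φ with ⟨h1', h2', h3'⟩ | ⟨h1', h2'⟩
        · left; simp [h1, h2, h1', h2', h3, h3']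
        · right; simpa [h1, h2, h1'] using h2'
      · right; simpa [h1] using h2
    · intro φ _
      have hU : {ψ | dist (f ψ) (f φ) < ε / 2} ∈ 𝓝 φ :=
        f.continuous_toFun.continuousAt (Metric.ball_mem_nhds _ (half_pos hε))
      obtain ⟨e, F, hφ, hsub⟩ := exists_basicClopen_subset hU
      obtain ⟨p, hp, h⟩ := exists_indicator_basicClopen e F
      -- Openness is read off from the continuous indicator `p`: the set is where `p ≠ 0`.
      have hopen : basicClopen e F ∈ 𝓝 φ := by
        have : ∀ᶠ ψ in 𝓝 φ, p ψ ≠ 0 :=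
          p.continuous_toFun.continuousAt.eventually_ne (by
            show p φ ≠ 0
            simp [h, hφ])
        filter_upwards [this] with ψ hψ
        by_contra hc
        simp [h, hc] at hψ
      refine ⟨_, mem_nhdsWithin_of_mem_nhds hopen, p, hp, f φ • p, SMulMemClass.smul_mem _ hp,
        fun ψ => ?_⟩
      rw [ZeroAtInftyContinuousMap.smul_apply, h]
      by_cases hψ : ψ ∈ basicClopen e F
      · right
        have hd : dist (f ψ) (f φ) < ε / 2 := hsub hψ
        simpa [hψ, dist_eq_norm] using hd.le
      · left; simp [hψ]
  have hf : {φ | ‖f φ‖ < ε / 2} ∈ cocompact (Character E) := by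
    filter_upwards [f.zero_at_infty' (Metric.ball_mem_nhds 0 (half_pos hε))] with φ hφ
    simpa using hφ
  obtain ⟨K, hK, hKf⟩ := mem_cocompact.1 hf
  obtain ⟨p, -, g, hg, h⟩ := hloc K hK
  refine ⟨g, hg, lt_of_le_of_lt ?_ (half_lt_self hε)⟩
  rw [← ZeroAtInftyContinuousMap.dist_toBCF_eq_dist]
  refine (BoundedContinuousFunction.dist_le (half_pos hε).le).2 fun φ => ?_
  show dist (f φ) (g φ) ≤ ε / 2
  rw [dist_eq_norm]
  rcases h φ with ⟨-, h2, h3⟩ | ⟨-, h2⟩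
  · rw [h2, sub_zero]; exact (hKf h3 : ‖f φ‖ < ε / 2).le
  · exact h2

/-- Near a point where `f` does not vanish, `f` has a local inverse. -/
theorem exists_mul_eq_indicator {f : C₀(Character E, ℂ)} {φ : Character E} (hf : f φ ≠ 0) :
    ∃ e F, φ ∈ basicClopen e F ∧ ∃ g : C₀(Character E, ℂ),
      ∀ ψ, (f * g) ψ = if ψ ∈ basicClopen e F then 1 else 0 := by
  set c := ‖f φ‖ / 2 with hc
  have hc0 : 0 < c := half_pos (norm_pos_iff.2 hf)
  have hU : {ψ | c < ‖f ψ‖} ∈ 𝓝 φ :=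
    (f.continuous_toFun.norm.continuousAt (x := φ)).eventually_const_lt
      (half_lt_self (norm_pos_iff.2 hf))
  obtain ⟨e, F, hφ, hsub⟩ := exists_basicClopen_subset hU
  obtain ⟨p, -, hp⟩ := exists_indicator_basicClopen e F
  -- `k z` equals `1 / z` for `‖z‖ ≥ c`. The cutoff `c ^ 2` keeps it continuous with `k 0 = 0`, so
  -- that `k ∘ f` vanishes at infinity.
  let k : ℂ → ℂ := fun z => star z / ((max (‖z‖ ^ 2) (c ^ 2) : ℝ) : ℂ)
  have hpos : ∀ z : ℂ, (0 : ℝ) < max (‖z‖ ^ 2) (c ^ 2) := fun z =>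
    lt_max_of_lt_right (by positivity)
  have hk : Continuous k := by
    refine continuous_star.div (Complex.continuous_ofReal.comp (by fun_prop)) fun z => ?_
    exact_mod_cast (hpos z).ne'
  let g : C₀(Character E, ℂ) :=
    { toFun := fun ψ => k (f ψ)
      continuous_toFun := hk.comp f.continuous_toFun
      zero_at_infty' := by
        have h := (hk.tendsto 0).comp f.zero_at_infty'
        rwa [show k 0 = 0 by simp [k]] at h }
  refine ⟨e, F, hφ, g * p, fun ψ => ?_⟩
  rw [ZeroAtInftyContinuousMap.mul_apply, ZeroAtInftyContinuousMap.mul_apply, hp]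
  split_ifs with hψ
  · have h1 : c < ‖f ψ‖ := hsub hψ
    have h0 : f ψ ≠ 0 := norm_pos_iff.1 (hc0.trans h1)
    show f ψ * (star (f ψ) / ((max (‖f ψ‖ ^ 2) (c ^ 2) : ℝ) : ℂ) * 1) = 1
    rw [max_eq_left (by gcongr), mul_one, ← mul_div_assoc, Complex.star_def, Complex.mul_conj']
    push_cast
    exact div_self (by simpa using h0)
  · simp

end BasicClopens

/-! ### Diagonal operators and compactness of coordinate projections -/

section Diagonal

variable {Ω : Type*}

theorem sum_diag_le {d : Ω → ℂ} {C : ℝ} (hC : 0 ≤ C) (hd : ∀ ν, ‖d ν‖ ≤ C) (x : Ell2 Ω)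
    (s : Finset Ω) :
    ∑ ν ∈ s, ‖d ν * x ν‖ ^ (2 : ENNReal).toReal ≤ (C * ‖x‖) ^ (2 : ENNReal).toReal := by
  rw [Real.mul_rpow hC (norm_nonneg _)]
  refine le_trans ?_ (mul_le_mul_of_nonneg_left (lp.sum_rpow_le_norm_rpow (by simp) x s)
    (by positivity))
  rw [Finset.mul_sum]
  refine Finset.sum_le_sum fun ν _ => ?_
  rw [norm_mul, Real.mul_rpow (norm_nonneg _) (norm_nonneg _)]
  gcongr
  exact hd ν

/-- The diagonal operator on `ℓ²(Ω)` with entries `d`, bounded by `C`. -/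
def diagOp (d : Ω → ℂ) (C : ℝ) (hC : 0 ≤ C) (hd : ∀ ν, ‖d ν‖ ≤ C) : Ell2 Ω →L[ℂ] Ell2 Ω :=
  LinearMap.mkContinuous
    { toFun := fun x => ⟨fun ν => d ν * x ν, memℓp_gen' (sum_diag_le hC hd x)⟩
      map_add' := fun x y => by ext ν; exact mul_add _ _ _
      map_smul' := fun c x => by ext ν; exact mul_left_comm _ _ _ } C
    (fun x => lp.norm_le_of_forall_sum_le (by simp) (mul_nonneg hC (norm_nonneg x))
      (sum_diag_le hC hd x))

theorem norm_diagOp_le (d : Ω → ℂ) (C : ℝ) (hC : 0 ≤ C) (hd : ∀ ν, ‖d ν‖ ≤ C) :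
    ‖diagOp d C hC hd‖ ≤ C :=
  by
  unfold diagOp
  exact LinearMap.mkContinuous_norm_le _ hC _

theorem diagOp_apply (d : Ω → ℂ) (C : ℝ) (hC : 0 ≤ C) (hd : ∀ ν, ‖d ν‖ ≤ C) (x : Ell2 Ω) (ν : Ω) :
    diagOp d C hC hd x ν = d ν * x ν := rfl

theorem star_diagOp (d : Ω → ℂ) (C : ℝ) (hC : 0 ≤ C) (hd : ∀ ν, ‖d ν‖ ≤ C) :
    star (diagOp d C hC hd) =
      diagOp (fun ν => star (d ν)) C hC (fun ν => (norm_star (d ν)).trans_le (hd ν)) := by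
  rw [ContinuousLinearMap.star_eq_adjoint, eq_comm, ContinuousLinearMap.eq_adjoint_iff]
  intro x y
  rw [lp.inner_eq_tsum, lp.inner_eq_tsum]
  refine tsum_congr fun ν => ?_
  rw [diagOp_apply, diagOp_apply, RCLike.inner_apply, RCLike.inner_apply, map_mul,
    Complex.star_def, Complex.conj_conj]
  ring

theorem tau_idOn_apply (Z : Set Ω) (x : Ell2 Ω) (ν : Ω) :
    tau (idOn Z) x ν = if ν ∈ Z then x ν else 0 := by
  rw [tau_apply]
  have h : (idOn Z).symm ν = if ν ∈ Z then some ν else none := by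
    show (if _ : ν ∈ Z then some ν else none) = _
    split_ifs <;> rfl
  rw [h]
  split_ifs <;> rfl

theorem tau_idOn_diff (Y Z : Set Ω) :
    tau (idOn (Y \ Z)) = tau (idOn Y) - tau (idOn Y) * tau (idOn Z) := by
  ext x ν
  show _ = tau (idOn Y) x ν - tau (idOn Y) (tau (idOn Z) x) ν
  simp only [tau_idOn_apply, Set.mem_sdiff]
  by_cases h1 : ν ∈ Y <;> by_cases h2 : ν ∈ Z <;> simp [h1, h2]

/-- The coordinate projection onto a set is compact precisely when the set is finite. -/
theorem isCompactOperator_tau_idOn_iff (Z : Set Ω) :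
    IsCompactOperator (tau (idOn Z)) ↔ Z.Finite := by
  constructor
  · intro h
    by_contra hZ
    -- The projection fixes infinitely many distinct basis vectors, which would need a convergent
    -- subsequence.
    let u : ℕ → Ω := fun n => (Set.Infinite.natEmbedding Z hZ n).1
    have hu : Function.Injective u :=
      Subtype.val_injective.comp (Set.Infinite.natEmbedding Z hZ).injective
    have hc := (isCompactOperator_iff_isCompact_closure_image_closedBall
      (tau (idOn Z)).toLinearMap one_pos).1 h
    have hmem : ∀ n, (lp.single 2 (u n) (1 : ℂ) : Ell2 Ω) ∈
        closure ((tau (idOn Z)).toLinearMap '' Metric.closedBall 0 1) := by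
      refine fun n => subset_closure ⟨lp.single 2 (u n) (1 : ℂ), ?_, ?_⟩
      · rw [mem_closedBall_zero_iff, lp.norm_single (by simp)]; simp
      · ext ν
        show tau (idOn Z) _ ν = _
        rw [tau_idOn_apply]
        split_ifs with hν
        · rfl
        · rw [lp.single_apply_ne]
          rintro rfl
          exact hν (Set.Infinite.natEmbedding Z hZ n).2
    obtain ⟨a, -, φ, hφ, hlim⟩ := hc.tendsto_subseq hmem
    have hcau := hlim.cauchySeq
    rw [Metric.cauchySeq_iff] at hcau
    obtain ⟨N, hN⟩ := hcau 1 one_pos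
    have hd := hN N le_rfl (N + 1) (Nat.le_succ N)
    have hne : u (φ N) ≠ u (φ (N + 1)) := fun he =>
      (hφ (Nat.lt_succ_self N)).ne (hu he)
    -- A single coordinate of the difference of two distinct basis vectors equals `1`, so they are
    -- at distance at least `1`, against the Cauchy bound.
    have hle := lp.norm_apply_le_norm (p := 2) (by simp)
      ((lp.single 2 (u (φ N)) (1 : ℂ) : Ell2 Ω) - lp.single 2 (u (φ (N + 1))) (1 : ℂ)) (u (φ N))
    rw [lp.coeFn_sub, Pi.sub_apply, lp.single_apply_self, lp.single_apply_ne _ _ _ hne] at hle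
    rw [dist_eq_norm] at hd
    simp only [Function.comp_apply] at hd
    rw [sub_zero, norm_one] at hle
    exact absurd hd (not_lt.2 hle)
  · intro hZ
    induction Z, hZ using Set.Finite.induction_on with
    | empty =>
      rw [show tau (idOn (∅ : Set Ω)) = 0 by ext x ν; simp [tau_idOn_apply]]
      exact isCompactOperator_zero
    | @insert a Z ha _ ih =>
      -- The rank-one projection onto `δ_a`, factored through `ℂ`.
      have hone : IsCompactOperator ((lp.singleContinuousLinearMap ℂ (fun _ : Ω => ℂ) 2 a).comp
          (lp.evalCLM ℂ (fun _ : Ω => ℂ) 2 a)) :=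
        (isCompactOperator_of_locallyCompactSpace_dom
          (lp.evalCLM ℂ (fun _ : Ω => ℂ) 2 a)).clm_comp
          (lp.singleContinuousLinearMap ℂ (fun _ : Ω => ℂ) 2 a)
      have : tau (idOn (insert a Z)) = (lp.singleContinuousLinearMap ℂ (fun _ : Ω => ℂ) 2 a).comp
          (lp.evalCLM ℂ (fun _ : Ω => ℂ) 2 a) + tau (idOn Z) := by
        ext x ν
        show _ = (lp.single 2 a (x a) : Ell2 Ω) ν + tau (idOn Z) x ν
        rw [tau_idOn_apply, tau_idOn_apply]
        by_cases hν : ν = a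
        · subst hν; simp [ha]
        · simp [hν]
      rw [this]
      exact hone.add ih

end Diagonal

/-! ### The induced homomorphism, its kernel and its support -/

section Spectrum

/-- The equalizer is a `*`-subalgebra containing the generators. No continuity of `Ψ` is needed,
because indicators of basic clopen sets already lie in the algebraic span. -/
theorem IsInduced.eqOn_adjoin {E A : Type*} [SemilatticeInf E] [OrderBot E] [NonUnitalSemiring A]
    [Module ℂ A] [Star A] {π : E → A} {Ψ Φ : C₀(Character E, ℂ) →⋆ₙₐ[ℂ] A}
    (hΨ : IsInduced π Ψ) (hΦ : IsInduced π Φ) {p : C₀(Character E, ℂ)}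
    (hp : p ∈ NonUnitalStarAlgebra.adjoin ℂ (Set.range (charFun (E := E)))) : Ψ p = Φ p := by
  have hle : NonUnitalStarAlgebra.adjoin ℂ (Set.range (charFun (E := E))) ≤
      NonUnitalStarAlgHom.equalizer Ψ Φ := by
    refine NonUnitalStarAlgebra.adjoin_le ?_
    rintro _ ⟨Y, rfl⟩
    exact (hΨ Y).trans (hΦ Y).symm
  exact hle hp

variable {S : Type*} [SemigroupWithZero S] [ZeroLeftCancellative S]

/-- The value of `f` at the character `Y ↦ [ν ∈ Y]`, or `0` if that map vanishes identically. -/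
def evalPoint (f : C₀(Character (Constructible S), ℂ)) (ν : NonZero S) : ℂ :=
  if h : ∃ Y : Constructible S, ν ∈ Y.1 then
    f ⟨fun Y => decide (ν ∈ Y.1), decide_eq_false (Set.notMem_empty ν),
      fun Y Z => by
      rw [Bool.eq_iff_iff, Bool.and_eq_true, decide_eq_true_iff, decide_eq_true_iff,
        decide_eq_true_iff]; exact Iff.rfl, h.imp fun _ hY => decide_eq_true hY⟩
  else 0

theorem norm_evalPoint_le (f : C₀(Character (Constructible S), ℂ)) (ν : NonZero S) :
    ‖evalPoint f ν‖ ≤ ‖f‖ := by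
  rw [evalPoint]
  split_ifs with h
  · rw [← ZeroAtInftyContinuousMap.norm_toBCF_eq_norm]
    exact f.toBCF.norm_coe_le_norm _
  · simp

variable (S) in
/-- The representation of `C₀(Ê)` by diagonal operators, `1_Y ↦ π(id_Y)`. -/
def diagRep : C₀(Character (Constructible S), ℂ) →⋆ₙₐ[ℂ]
    (Ell2 (NonZero S) →L[ℂ] Ell2 (NonZero S)) where
  toFun f := diagOp (evalPoint f) ‖f‖ (norm_nonneg f) (norm_evalPoint_le f)
  map_smul' c f := by
    ext x ν
    show evalPoint (c • f) ν * x ν = c * (evalPoint f ν * x ν)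
    rw [evalPoint, evalPoint]
    split_ifs <;> simp [mul_assoc]
  map_zero' := by
    ext x ν
    show evalPoint 0 ν * x ν = 0
    simp [evalPoint]
  map_add' f g := by
    ext x ν
    show evalPoint (f + g) ν * x ν = evalPoint f ν * x ν + evalPoint g ν * x ν
    rw [evalPoint, evalPoint, evalPoint]
    split_ifs <;> simp [add_mul]
  map_mul' f g := by
    ext x ν
    show evalPoint (f * g) ν * x ν = evalPoint f ν * (evalPoint g ν * x ν)
    rw [evalPoint, evalPoint, evalPoint]
    split_ifs <;> simp [mul_assoc]
  map_star' f := by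
    rw [star_diagOp]
    ext x ν
    show evalPoint (star f) ν * x ν = star (evalPoint f ν) * x ν
    rw [evalPoint, evalPoint]
    split_ifs <;> simp

theorem diagRep_charFun (Y : Constructible S) : diagRep S (charFun Y) = tau (idOn Y.1) := by
  ext x ν
  rw [tau_idOn_apply]
  show evalPoint (charFun Y) ν * x ν = _
  rw [evalPoint]
  split_ifs with h1 h2 h2
  · simp [charFun_apply, h2]
  · simp [charFun_apply, h2]
  · exact absurd ⟨Y, h2⟩ h1
  · simp

/-- `diagRep` is contractive and sends each `1_Y` to `π(id_Y)`, so density of the `1_Y`-polynomials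
and closedness of `algT` suffice. -/
theorem diagRep_mem_algT (f : C₀(Character (Constructible S), ℂ)) : diagRep S f ∈ algT S := by
  have hcont : Continuous (diagRep S) := by
    refine AddMonoidHomClass.continuous_of_bound (diagRep S) 1 fun f => ?_
    rw [one_mul]
    exact norm_diagOp_le _ _ (norm_nonneg f) (norm_evalPoint_le f)
  have hle : NonUnitalStarAlgebra.adjoin ℂ (Set.range (charFun (E := Constructible S))) ≤
      (algT S).comap (diagRep S) := by
    refine NonUnitalStarAlgebra.adjoin_le ?_
    rintro _ ⟨Y, rfl⟩
    show diagRep S (charFun Y) ∈ algT S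
    rw [diagRep_charFun]
    exact repPi_mem Y.toHull
  have hclosed : IsClosed ((diagRep S) ⁻¹' (algT S : Set _)) :=
    (NonUnitalStarSubalgebra.isClosed_topologicalClosure _).preimage hcont
  exact closure_minimal hle hclosed (adjoin_charFun_dense f)

theorem calkinMap_mem_algM {T : Ell2 (NonZero S) →L[ℂ] Ell2 (NonZero S)} (hT : T ∈ algT S) :
    calkinMap _ T ∈ algM S :=
  ⟨T, ⟨T, hT, 0, zero_mem _, (add_zero T).symm⟩, rfl⟩

variable (S) in
/-- The `*`-homomorphism `C₀(Ê) → M` induced by the Matsumoto representation. -/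
def matsumotoHom : C₀(Character (Constructible S), ℂ) →⋆ₙₐ[ℂ] algM S where
  toFun f := ⟨calkinMap _ (diagRep S f), calkinMap_mem_algM (diagRep_mem_algT f)⟩
  map_smul' c f := Subtype.ext (by simp)
  map_zero' := Subtype.ext (by simp)
  map_add' f g := Subtype.ext (by simp)
  map_mul' f g := Subtype.ext (by simp)
  map_star' f := Subtype.ext
    ((congrArg (calkinMap _) (map_star (diagRep S) f)).trans (map_star (calkinMap _) _))

theorem isInduced_matsumotoHom :
    IsInduced (fun Y : Constructible S => rho Y.toHull) (matsumotoHom S) := fun Y =>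
  Subtype.ext (congrArg (calkinMap _) (diagRep_charFun Y))

/-- The character `Z ↦ [ν ∈ Z]` lies in `basicClopen Y F` exactly when `ν ∈ Y \ ⋃ F`. If `ν` is in
no constructible set, both diagonal entries are `0`. -/
theorem diagRep_indicator {Y : Constructible S} {F : Finset (Constructible S)}
    {p : C₀(Character (Constructible S), ℂ)}
    (hp : ∀ φ, p φ = if φ ∈ basicClopen Y F then 1 else 0) :
    diagRep S p = tau (idOn (Y.1 \ ⋃ Z ∈ F, Z.1)) := by
  ext x ν
  rw [tau_idOn_apply]
  show evalPoint p ν * x ν = _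
  rw [evalPoint]
  split_ifs with h1 h2 h2
  · rw [hp, if_pos, one_mul]
    simpa [basicClopen] using h2
  · rw [hp, if_neg, zero_mul]
    simpa [basicClopen] using h2
  · exact absurd ⟨Y, h2.1⟩ h1
  · exact zero_mul _

/-- An induced homomorphism kills the indicator of a basic clopen set exactly when the
corresponding set of words is finite. -/
theorem IsInduced.indicator_eq_zero_iff
    {Ψ : C₀(Character (Constructible S), ℂ) →⋆ₙₐ[ℂ] algM S}
    (hΨ : IsInduced (fun Y => rho Y.toHull) Ψ) {Y : Constructible S}
    {F : Finset (Constructible S)} {p : C₀(Character (Constructible S), ℂ)}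
    (hp : ∀ φ, p φ = if φ ∈ basicClopen Y F then 1 else 0) :
    Ψ p = 0 ↔ (Y.1 \ ⋃ Z ∈ F, Z.1).Finite := by
  obtain ⟨p', hp'D, hp'⟩ := exists_indicator_basicClopen Y F
  -- The values determine `p`, so `p` is one of the polynomials in the `1_Z`, and `Ψ p` can be
  -- computed with `matsumotoHom`.
  obtain rfl : p = p' := ZeroAtInftyContinuousMap.ext fun φ => (hp φ).trans (hp' φ).symm
  rw [hΨ.eqOn_adjoin isInduced_matsumotoHom hp'D, ← isCompactOperator_tau_idOn_iff, ← diagRep_indicator hp,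
    Subtype.ext_iff]
  exact Ideal.Quotient.eq_zero_iff_mem

/-- Both conditions on `φ` amount to this: `φ` avoids every `basicClopen W F` for which `W \ ⋃ F` is
finite. -/
theorem support_eq_essentiallyTight {Ψ : C₀(Character (Constructible S), ℂ) →⋆ₙₐ[ℂ] algM S}
    (hΨ : IsInduced (fun Y => rho Y.toHull) Ψ) : support Ψ = essentiallyTight S := by
  ext φ
  constructor
  · intro hφ Y n Z hfin
    have hempty : ∀ (W : Constructible S) (F : Finset (Constructible S)),
        (W.1 \ ⋃ V ∈ F, V.1).Finite → φ ∉ basicClopen W F := by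
      intro W F hWF hmem
      obtain ⟨p, -, hp⟩ := exists_indicator_basicClopen W F
      have h := hφ p ((hΨ.indicator_eq_zero_iff hp).2 hWF)
      rw [hp, if_pos hmem] at h
      exact one_ne_zero h
    constructor
    · intro hY
      by_contra hZ
      -- The two implications use the two halves of the symmetric difference: here `Y \ ⋃ Z i`,
      -- below `Z i \ Y`.
      refine hempty Y (Finset.univ.image Z) (hfin.subset ?_) ⟨hY, by simpa using hZ⟩
      intro ν hν
      left
      simpa using hν
    · rintro ⟨i, hi⟩
      by_contra hY
      refine hempty (Z i) {Y} (hfin.subset ?_) ⟨hi, by simpa using hY⟩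
      intro ν hν
      right
      simp only [Finset.mem_singleton, Set.iUnion_iUnion_eq_left] at hν
      exact ⟨Set.mem_iUnion.2 ⟨i, hν.1⟩, hν.2⟩
  · intro hφ f hf
    by_contra hne
    obtain ⟨Y, F, ⟨hY, hF⟩, g, hg⟩ := exists_mul_eq_indicator hne
    -- The kernel is an ideal, so it contains the indicator `f * g` along with `f`.
    have hfin := (hΨ.indicator_eq_zero_iff hg).1 (by rw [map_mul, hf, zero_mul])
    -- Intersecting with `Y` keeps the union inside `Y`, so the symmetric difference reduces to the
    -- finite set `Y \ ⋃ F`. Yet `φ (Z i) = 0` for every `i`, as `φ` is `0` on `F`.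
    let Z : Fin F.card → Constructible S := fun i => Y ⊓ (F.equivFin.symm i).1
    have hsub : symmDiff Y.1 (⋃ i, (Z i).1) ⊆ Y.1 \ ⋃ V ∈ F, V.1 := by
      rintro ν (⟨hν, hn⟩ | ⟨hν, hn⟩)
      · refine ⟨hν, fun hU => hn ?_⟩
        simp only [Set.mem_iUnion] at hU ⊢
        obtain ⟨V, hV, hνV⟩ := hU
        refine ⟨F.equivFin ⟨V, hV⟩, hν, ?_⟩
        rw [Equiv.symm_apply_apply]
        exact hνV
      · obtain ⟨i, hi⟩ := Set.mem_iUnion.1 hν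
        exact absurd hi.1 hn
    obtain ⟨i, hi⟩ := (hφ Y F.card Z (hfin.subset hsub)).1 hY
    rw [φ.2.2.1, hF _ (F.equivFin.symm i).2, Bool.and_false] at hi
    exact Bool.false_ne_true hi

end Spectrum

end

end Matsumoto

theorem mainTheorem10 {A : Type*} [Finite A] [TopologicalSpace A] [DiscreteTopology A]
    (X : SymbolicDynamics.FullShift.Subshift A ℕ) :
    (∃ Ψ : C₀(Character (Constructible (SX X)), ℂ) →⋆ₙₐ[ℂ] algM (SX X),
      IsInduced (fun Y => rho Y.toHull) Ψ) ∧
    ∀ Ψ : C₀(Character (Constructible (SX X)), ℂ) →⋆ₙₐ[ℂ] algM (SX X),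
      IsInduced (fun Y => rho Y.toHull) Ψ → support Ψ = essentiallyTight (SX X) :=
  ⟨⟨matsumotoHom (SX X), isInduced_matsumotoHom⟩, fun _ hΨ => support_eq_essentiallyTight hΨ⟩
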